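/- **Surface ribbons.** A *surface ribbon* $S$ is a compact orientable surface embedded in $3$-space, every component of which has non-empty boundary, in the form of a thickened flat trivalent graph. It is given by a diagram $D$: a finite trivalent spatial graph, projected to the plane with finitely many transverse double points and over/under information, in which each edge stands for a ribbon (a pair of parallel arcs) lying flat with respect to the projection. Components whose spine has no trivalent vertex are allowed: closed ribbons (annuli), and disks. A disk, and an annulus that is drawn as a simple closed ribbon without crossings, are split from the rest of the surface. The spine may be disconnected, and the empty surface is admitted. **Fundamental heap.** A *heap* is a non-empty set with a ternary operation satisfying $[[a,b,c],d,e]=[a,[d,c,b],e]=[a,b,[c,d,e]]$, $[x,x,y]=y$ and $[x,y,y]=x$; every group is a heap with $[x,y,z]=xy^{-1}z$ (its *group heap*), and an isomorphism of heaps is a bijection preserving the operation. Let $\mathcal A$ be the set of arcs of the doubled diagram, i.e. the connected pieces of the boundary curves after these are cut wherever they pass under a ribbon (arcs continue around the corners at trivalent vertices and along over-crossing ribbons). Whenever an arc $x$ passes under the two arcs $u,v$ of a ribbon, first under $u$ and then under $v$, and continues as the arc $z$, impose the relation $z=xu^{-1}v$. The *fundamental heap* $h(S)$ is the group heap of the group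 $\langle \mathcal A\mid z=xu^{-1}v \text{ (two relations for each crossing)}\rangle$. In particular a disk component contributes one free generator, and an annulus without crossings two. **Proposition.** For every surface ribbon $S$ there exists a surface ribbon $S^*$ with $h(S^*)\cong h(S)$ such that $\chi(T)\le\chi(S^*)$ for every surface ribbon $T$ with $h(T)\cong h(S)$, where $\chi$ denotes the Euler characteristic of the surface. -/

import Mathlib

/-! ### Heaps -/

/-- A heap: a non-empty set with a ternary operation that is para-associative and
satisfies the two degeneracy conditions. -/
class TernaryHeap (X : Type*) where
  bracket : X → X → X → X
  nonempty : Nonempty X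
  para_assoc_left : ∀ a b c d e,
    bracket (bracket a b c) d e = bracket a (bracket d c b) e
  para_assoc_right : ∀ a b c d e,
    bracket a (bracket d c b) e = bracket a b (bracket c d e)
  bracket_left : ∀ x y, bracket x x y = y
  bracket_right : ∀ x y, bracket x y y = x

/-- The group heap of a group, `[x, y, z] = x y⁻¹ z`. -/
@[reducible] def groupHeap (G : Type*) [Group G] : TernaryHeap G where
  bracket x y z := x * y⁻¹ * z
  nonempty := ⟨1⟩
  para_assoc_left a b c d e := by group
  para_assoc_right a b c d e := by group
  bracket_left x y := by group
  bracket_right x y := by group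

/-- Heap isomorphisms: bijections that preserve the ternary operation. -/
structure HeapIso (X Y : Type*) [TernaryHeap X] [TernaryHeap Y] extends X ≃ Y where
  map_bracket : ∀ a b c, toFun (TernaryHeap.bracket a b c) =
    TernaryHeap.bracket (toFun a) (toFun b) (toFun c)

/-! ### Surface ribbons -/

/-- The half-edges ("darts") of a diagram with `m` crossings and `n` trivalent vertices: four at
each crossing and three at each vertex, numbered cyclically in counterclockwise order around the
crossing or vertex. At a crossing, `0` and `2` are the two halves of the under-strand, `1` and `3`
are the two halves of the over-strand. -/
abbrev RibbonDart (m n : ℕ) : Type := (Fin m × Fin 4) ⊕ (Fin n × Fin 3)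

/-- The next dart in counterclockwise order around the same crossing or vertex
(addition in `Fin 4` and `Fin 3` is cyclic). -/
def RibbonDart.next {m n : ℕ} : RibbonDart m n → RibbonDart m n
  | .inl (c, i) => .inl (c, i + 1)
  | .inr (v, i) => .inr (v, i + 1)

/-- A surface ribbon, given by a diagram: a trivalent graph diagram in the plane (or sphere) each
of whose edges stands for a flat ribbon (a pair of parallel arcs) in the plane of projection, with
over/under information at the crossings. `opposite` matches the two ends of every segment of the
diagram between consecutive crossings/vertices. Planarity of the underlying four- and three-valent
map is Euler's formula: nodes - segments + faces = 2 * (connected components of the projection),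
which says that every connected component of the projection has genus zero.

Components of the surface whose spine has neither vertices nor crossings are recorded by their
number: `circles` is the number of flat annuli (simple closed ribbons without crossings), `disks`
is the number of disks. Both kinds are split from the rest of the surface. -/
structure SurfaceRibbon where
  crossings : ℕ
  vertices : ℕ
  opposite : RibbonDart crossings vertices → RibbonDart crossings vertices
  opposite_opposite : ∀ d, opposite (opposite d) = d
  opposite_ne : ∀ d, opposite d ≠ d
  planar : (crossings + vertices : ℤ) - Nat.card (Quot fun d e => e = opposite d) +
      Nat.card (Quot fun d e => e = (opposite d).next) =
    2 * Nat.card (Quot fun d e => e = opposite d ∨ e = d.next)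
  circles : ℕ
  disks : ℕ

namespace SurfaceRibbon

/-- The darts of the diagram. -/
abbrev Dart (S : SurfaceRibbon) : Type := RibbonDart S.crossings S.vertices

/-- The two sides of the ribbon at every dart: `(d, true)` is the left side and `(d, false)` the
right side, as seen when looking along `d` away from its crossing or vertex. -/
abbrev Side (S : SurfaceRibbon) : Type := S.Dart × Bool

/-- The sides that are directly joined into the same arc: along a segment of the diagram (left and
right are exchanged when the segment is seen from its other end), around the corner between two
consecutive darts at a trivalent vertex, and along the over-strand of a crossing. -/
inductive Joined (S : SurfaceRibbon) : S.Side → S.Side → Prop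
  | segment (d : S.Dart) (b : Bool) : Joined S (d, b) (S.opposite d, !b)
  | vertex (v : Fin S.vertices) (i : Fin 3) :
      Joined S (Sum.inr (v, i), true) (Sum.inr (v, i + 1), false)
  | over (c : Fin S.crossings) (b : Bool) :
      Joined S (Sum.inl (c, 1), b) (Sum.inl (c, 3), !b)

/-- The arcs of the doubled diagram: the connected pieces of its boundary curves, cut where they
pass under a ribbon. Each flat annulus has two arcs and each disk has one. -/
abbrev Arc (S : SurfaceRibbon) : Type :=
  Quot S.Joined ⊕ (Fin S.circles × Bool) ⊕ Fin S.disks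

/-- The generator belonging to side `b` of the ribbon at the `i`-th dart of the crossing `c`. -/
def gen (S : SurfaceRibbon) (c : Fin S.crossings) (i : Fin 4) (b : Bool) : FreeGroup S.Arc :=
  FreeGroup.of (Sum.inl (Quot.mk _ (Sum.inl (c, i), b)))

/-- The relations: on the way from dart `0` to dart `2` of a crossing, each of the two arcs `x` of
the under-ribbon passes first under the arc `u` (the right side of dart `1`) and then under the arc
`v` (the left side of dart `1`) of the over-ribbon; for its continuation `z` beyond the
over-ribbon the relation is `z = x u⁻¹ v`. -/
def relators (S : SurfaceRibbon) : Set (FreeGroup S.Arc) :=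
  {r | ∃ (c : Fin S.crossings) (b : Bool),
    r = S.gen c 0 b * (S.gen c 1 false)⁻¹ * S.gen c 1 true * (S.gen c 2 (!b))⁻¹}

/-- The group presented by the arcs and the crossing relations. -/
abbrev FundamentalHeap (S : SurfaceRibbon) : Type := PresentedGroup S.relators

/-- The fundamental heap is the group heap of that group. -/
instance (S : SurfaceRibbon) : TernaryHeap S.FundamentalHeap := groupHeap S.FundamentalHeap

/-! The Euler characteristic, by the following cell structure of the surface. The ribbons are cut
across in the middle of every segment of the diagram; every trivalent vertex then gives a hexagon
(three cuts alternating with three boundary pieces) and every crossing gives two rectangles (one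
for each strand, with two cuts and two boundary pieces). A flat annulus is cut once into a
rectangle; a disk has one 0-cell, one 1-cell and one 2-cell. -/

/-- The 0-cells: the end points of the cuts. -/
abbrev Cell0 (S : SurfaceRibbon) : Type :=
  Quot (fun s t : S.Side => t = (S.opposite s.1, !s.2)) ⊕ (Fin S.circles × Bool) ⊕ Fin S.disks

/-- The 1-cells: the cuts across the segments of the diagram; the boundary pieces, one starting at
the left side of each dart; for each annulus a cut and two boundary circles; a boundary circle for
each disk. -/
abbrev Cell1 (S : SurfaceRibbon) : Type :=
  Quot (fun d e : S.Dart => e = S.opposite d) ⊕ S.Dart ⊕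
    (Fin S.circles ⊕ (Fin S.circles × Bool)) ⊕ Fin S.disks

/-- The 2-cells: two rectangles at each crossing (`Bool` tells the strand), a hexagon at each
vertex, one rectangle for each annulus, and one cell for each disk. -/
abbrev Cell2 (S : SurfaceRibbon) : Type :=
  (Fin S.crossings × Bool) ⊕ Fin S.vertices ⊕ Fin S.circles ⊕ Fin S.disks

/-- The Euler characteristic of the surface. -/
noncomputable def eulerChar (S : SurfaceRibbon) : ℤ :=
  (Nat.card S.Cell0 : ℤ) - Nat.card S.Cell1 + Nat.card S.Cell2

end SurfaceRibbon

/-!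
The Euler characteristics of the surface ribbons with a given fundamental heap are bounded above,
so one of them is the largest.

The Euler characteristic of `T` is `T.disks - T.vertices / 2`, because flat annuli and crossings
contribute nothing and each trivalent vertex contributes `-1/2`; only the bound by `T.disks` is
needed (`SurfaceRibbon.eulerChar_le_disks`). The number of disks is controlled by the heap. An
isomorphism of group heaps becomes, after a translation, an isomorphism of groups
(`HeapIso.toMulEquiv`). The disks of `T` give free generators that occur in no relation, so the
group of `T` has at least `2 ^ T.disks` homomorphisms to the group of order two, while the group
of `S`, generated by the arcs of `S`, has at most `2 ^ #arcs`. Hence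
`T.disks ≤ #arcs` (`SurfaceRibbon.disks_le_card_arc`), a bound that depends on `S` alone.
-/

/-- The identity, as an isomorphism of heaps. -/
def HeapIso.refl (X : Type*) [TernaryHeap X] : HeapIso X X where
  toEquiv := Equiv.refl X
  map_bracket _ _ _ := rfl

/-- An isomorphism `f` of group heaps, translated so as to fix the unit: `x ↦ (f 1)⁻¹ * f x` is an
isomorphism of groups. -/
def HeapIso.toMulEquiv {G H : Type*} [Group G] [Group H]
    (f : @HeapIso G H (groupHeap G) (groupHeap H)) : G ≃* H :=
  letI := groupHeap G
  letI := groupHeap H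
  { f.toEquiv.trans (Equiv.mulLeft (f.toEquiv 1)⁻¹) with
    map_mul' := fun x y => by
      -- The product is the bracket `[x, 1, y]`.
      have h : f.toEquiv (x * 1⁻¹ * y) = f.toEquiv x * (f.toEquiv 1)⁻¹ * f.toEquiv y :=
        f.map_bracket x 1 y
      rw [inv_one, mul_one] at h
      simp [h, mul_assoc] }

namespace SurfaceRibbon

/-- Every end point of a cut is on the left side of one of the two darts of its segment. -/
lemma card_quot_side_le (S : SurfaceRibbon) :
    Nat.card (Quot fun s t : S.Side => t = (S.opposite s.1, !s.2)) ≤ Nat.card S.Dart := by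
  refine Nat.card_le_card_of_surjective (fun d : S.Dart => Quot.mk _ (d, true)) ?_
  rintro ⟨d, b⟩
  cases b
  · refine ⟨S.opposite d, Eq.symm (Quot.sound ?_)⟩
    rfl
  · exact ⟨d, rfl⟩

/-- A segment of the diagram has at most two darts. -/
lemma card_dart_le (S : SurfaceRibbon) :
    Nat.card S.Dart ≤ 2 * Nat.card (Quot fun d e : S.Dart => e = S.opposite d) := by
  let ends : (Quot fun d e : S.Dart => e = S.opposite d) → Sym2 S.Dart :=
    Quot.lift (fun d => s(d, S.opposite d)) (by
      rintro d _ rfl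
      simp [S.opposite_opposite, Sym2.eq_swap])
  have h := Nat.card_le_card_of_surjective
    (fun p : Bool × (Quot fun d e : S.Dart => e = S.opposite d) =>
      if p.1 then p.2.out else S.opposite p.2.out) (fun d => by
        have hd : s((Quot.mk _ d : Quot fun d e : S.Dart => e = S.opposite d).out,
            S.opposite (Quot.mk _ d : Quot fun d e : S.Dart => e = S.opposite d).out) =
            s(d, S.opposite d) :=
          congrArg ends (Quot.out_eq (Quot.mk _ d))
        rcases Sym2.eq_iff.1 hd with h | h
        · exact ⟨(true, Quot.mk _ d), h.1⟩
        · exact ⟨(false, Quot.mk _ d), h.2⟩)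
  simpa [Nat.card_prod] using h

lemma eulerChar_le_disks (S : SurfaceRibbon) : S.eulerChar ≤ S.disks := by
  have h0 := S.card_quot_side_le
  have h1 := S.card_dart_le
  have hd : Nat.card S.Dart = S.crossings * 4 + S.vertices * 3 := by simp
  simp only [eulerChar, Cell0, Cell1, Cell2, Nat.card_sum, Nat.card_prod, Nat.card_fin,
    Nat.card_eq_fintype_card (α := Bool), Fintype.card_bool]
  lia

/-- The boundary arcs of the disks occur in no relation, so their images in a group can be
prescribed at will. -/
def homOfDisks (S : SurfaceRibbon) {A : Type*} [Group A] (s : Fin S.disks → A) :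
    S.FundamentalHeap →* A :=
  PresentedGroup.toGroup (f := Sum.elim (fun _ => 1) (Sum.elim (fun _ => 1) s)) (by
    rintro _ ⟨c, b, rfl⟩
    simp [gen])

lemma homOfDisks_injective (S : SurfaceRibbon) {A : Type*} [Group A] :
    Function.Injective (S.homOfDisks : (Fin S.disks → A) → (S.FundamentalHeap →* A)) := by
  intro s t h
  funext i
  simpa [homOfDisks] using
    DFunLike.congr_fun h (PresentedGroup.of (Sum.inr (Sum.inr i) : S.Arc))

/-- A ribbon whose fundamental heap is that of `S` has at most as many disks as `S` has arcs. -/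
lemma disks_le_card_arc {S T : SurfaceRibbon} (f : HeapIso T.FundamentalHeap S.FundamentalHeap) :
    T.disks ≤ Nat.card S.Arc := by
  let A := Multiplicative (ZMod 2)
  let e : T.FundamentalHeap ≃* S.FundamentalHeap := f.toMulEquiv
  let restrict : (Fin T.disks → A) → S.Arc → A := fun s a =>
    T.homOfDisks s (e.symm (PresentedGroup.of a))
  have hr : Function.Injective restrict := fun s t h => by
    apply T.homOfDisks_injective
    -- The arcs of `S` generate its group, so a homomorphism is determined by its values on them.
    have h' : (T.homOfDisks s).comp e.symm.toMonoidHom =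
        (T.homOfDisks t).comp e.symm.toMonoidHom :=
      PresentedGroup.ext fun a => congrFun h a
    refine MonoidHom.ext fun x => ?_
    simpa using DFunLike.congr_fun h' (e x)
  have hA : Nat.card A = 2 := Nat.card_zmod 2
  have hA' : Finite A := Nat.finite_of_card_ne_zero (by simp)
  have h := Nat.card_le_card_of_injective restrict hr
  rw [Nat.card_fun, Nat.card_fun, hA, Nat.card_fin] at h
  exact (Nat.pow_le_pow_iff_right one_lt_two).1 h

end SurfaceRibbon

theorem mainTheorem9 (S : SurfaceRibbon) :
    ∃ Smax : SurfaceRibbon,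
      Nonempty (HeapIso Smax.FundamentalHeap S.FundamentalHeap) ∧
      ∀ T : SurfaceRibbon, Nonempty (HeapIso T.FundamentalHeap S.FundamentalHeap) →
        T.eulerChar ≤ Smax.eulerChar := by
  obtain ⟨_, ⟨Smax, hS, rfl⟩, hmax⟩ := Int.exists_greatest_of_bdd
    (P := fun z => ∃ T : SurfaceRibbon,
      Nonempty (HeapIso T.FundamentalHeap S.FundamentalHeap) ∧ T.eulerChar = z)
    ⟨Nat.card S.Arc, by
      rintro _ ⟨T, ⟨f⟩, rfl⟩
      exact T.eulerChar_le_disks.trans (Int.ofNat_le.2 (SurfaceRibbon.disks_le_card_arc f))⟩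
    ⟨_, S, ⟨HeapIso.refl _⟩, rfl⟩
  exact ⟨Smax, hS, fun T hT => hmax _ ⟨T, hT, rfl⟩⟩
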